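/- **Syntax.** Fix a set $\mathcal R$ of registers. *Atomic terms* are $A ::= \mathsf{SKIP}\mid \mathsf{PUSH}[n]\,x\mid \mathsf{POP}[n]\,x$ ($n\in\mathbb N$, $x\in\mathcal R$), where $\mathsf{PUSH}[n]\,x$ and $\mathsf{POP}[n]\,x$ *write* $x$. *Safe terms* are $S ::= A\mid S;S\mid \mathsf{IF}\ x=n\ \{S\}\mid \mathsf{FOR}\ x\ \{S\}\cdots\{S\}\mid \mathsf{ROF}\ x\ \{S\}\cdots\{S\}$ (at least one body). *Raw terms* are $T ::= A\mid T;T\mid \mathsf{IF}\ x=n\ \{T\}\mid \mathsf{NORMAL}\ y_1,\dots,y_k\ \{S\}$ ($k\ge 1$). In $\mathsf{IF}$, $\mathsf{FOR}$ and $\mathsf{ROF}$ the register $x$ *leads* the selection or iteration; a register is *read-only* in a term if no atomic term in it writes that register. A raw term is a ForNo *term* if (i) every register leading a selection or an iteration is read-only in its bodies, and (ii) in every block $\mathsf{NORMAL}\ y_1,\dots,y_k\ \{S\}$ the registers $y_1,\dots,y_k$ are read-only in $S$ and are the only ones that lead iterations in $S$. **Semantics.** A *stack* is a finite list of natural numbers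 whose head is its top. A *state* is a pair $(\varphi,c)$ of a *store* $\varphi$, mapping registers to stacks, and a counter $c\in\mathbb N$. The operations $\mathrm{push}_n$ and $\mathrm{pop}_n$ on pairs $(s,c)$ are the mutually inverse maps $$\mathrm{pop}_n(s,c)=\begin{cases}(t,0)& s=n::t,\ c=0\\ (s,c)& s=n::t,\ c>0\\ (s,c+1)&\text{otherwise,}\end{cases}\qquad \mathrm{push}_n(s,c)=\begin{cases}(n::s,0)& c=0\\ (s,c)& s=n::t,\ c>0\\ (s,c-1)&\text{otherwise.}\end{cases}$$ Write $\langle T,\omega\rangle\Downarrow\omega'$ for the big-step evaluation: $\mathsf{SKIP}$ does nothing; $\mathsf{PUSH}[n]\,x$ and $\mathsf{POP}[n]\,x$ apply $\mathrm{push}_n$, $\mathrm{pop}_n$ to $(\varphi(x),c)$; $T;U$ evaluates $T$ and then $U$; $\mathsf{IF}\ x=n\ \{T\}$ evaluates $T$ if the top of $\varphi(x)$ is $n$, and otherwise (in particular if $\varphi(x)$ is empty) does nothing; $\mathsf{FOR}\ x\ \{P_0\}\cdots\{P_m\}$ runs through the entries $i$ of the stack $\varphi(x)$ from the top down and evaluates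 $P_{\min(i,m)}$ for each; $\mathsf{ROF}$ does the same with the reversed stack; $\mathsf{NORMAL}\ y_1,\dots,y_k\ \{S\}$ evaluates $S$. **Computed functions.** Let $\Sigma$ be a finite alphabet and $f:\Sigma^*\to\Sigma^*$ a total function. A term $T$ *computes* $f$ if there are a bijection $\langle\!\langle\cdot\rangle\!\rangle:\Sigma\to\{0,\dots,|\Sigma|-1\}$, extended letter by letter to a map from strings to stacks (first letter on top), and registers $\mathrm{in},\mathrm{out}$ (not necessarily distinct) such that for every $w\in\Sigma^*$ there is a store $\varphi$ with $\langle T,(\varnothing[\mathrm{in}\to\langle\!\langle w\rangle\!\rangle],0)\rangle\Downarrow(\varphi,0)$ and $\varphi(\mathrm{out})=\langle\!\langle f(w)\rangle\!\rangle$, where $\varnothing$ is the store with all registers empty. **FPTIME.** A function $f:\Sigma^*\to\Sigma^*$ is in FPTIME if there are a deterministic Turing machine $M$ and a polynomial $p$ such that for every $w\in\Sigma^*$, $M$, started in its initial state $q_0$ with only $w$ on its tape and the head on the leftmost cell, reaches its halting state $q_{\mathrm{halt}}$ after at most $p(|w|)$ steps, with only $f(w)$ on its tape and the head on the leftmost cell.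 Here $M$ has a finite set of states, one semi-infinite tape, a finite tape alphabet $\Gamma\supset\Sigma$ with a blank symbol in $\Gamma\setminus\Sigma$, and a transition function $\delta:(Q\setminus\{q_{\mathrm{halt}}\})\times\Gamma\to Q\times\Gamma\times\{L,R\}$; a move $L$ on the leftmost cell leaves the head where it is. **Theorem (FPTIME-soundness of ForNo).** For every ForNo term $T$ and every total function $f:\Sigma^*\to\Sigma^*$, if $T$ computes $f$, then $f$ is in FPTIME. -/

import Mathlib

namespace ForNo

universe u v

/-! ### Raw terms -/

/-- Atomic terms `A` over a set `R` of registers. -/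
inductive Atom (R : Type u) : Type u
  | skip : Atom R
  | push (n : ℕ) (x : R) : Atom R
  | pop (n : ℕ) (x : R) : Atom R

/-- Safe terms `S`. An iteration has a non-empty list of bodies `P 0, …, P n`. -/
inductive Safe (R : Type u) : Type u
  | atom (a : Atom R) : Safe R
  | seq (S₁ S₂ : Safe R) : Safe R
  | cond (x : R) (n : ℕ) (S : Safe R) : Safe R
  | forth (x : R) (n : ℕ) (P : Fin (n + 1) → Safe R) : Safe R
  | back (x : R) (n : ℕ) (P : Fin (n + 1) → Safe R) : Safe R

/-- Raw terms `T`. The non-empty list of registers of a normal block is `y :: ys`. -/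
inductive Term (R : Type u) : Type u
  | atom (a : Atom R) : Term R
  | seq (T₁ T₂ : Term R) : Term R
  | cond (x : R) (n : ℕ) (T : Term R) : Term R
  | normal (y : R) (ys : List R) (S : Safe R) : Term R

variable {R : Type u}

/-- The atomic term writes the register `x`. -/
def Atom.Writes (x : R) : Atom R → Prop
  | .skip => False
  | .push _ y => y = x
  | .pop _ y => y = x

/-- Some atomic term in the safe term writes `x` (otherwise `x` is read-only in it). -/
def Safe.Writes (x : R) : Safe R → Prop
  | .atom a => a.Writes x
  | .seq S₁ S₂ => S₁.Writes x ∨ S₂.Writes x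
  | .cond _ _ S => S.Writes x
  | .forth _ _ P => ∃ i, (P i).Writes x
  | .back _ _ P => ∃ i, (P i).Writes x

/-- Some atomic term in the term writes `x` (otherwise `x` is read-only in it). -/
def Term.Writes (x : R) : Term R → Prop
  | .atom a => a.Writes x
  | .seq T₁ T₂ => T₁.Writes x ∨ T₂.Writes x
  | .cond _ _ T => T.Writes x
  | .normal _ _ S => S.Writes x

/-- `x` leads some iteration occurring in the safe term. -/
def Safe.LeadsIteration (x : R) : Safe R → Prop
  | .atom _ => False
  | .seq S₁ S₂ => S₁.LeadsIteration x ∨ S₂.LeadsIteration x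
  | .cond _ _ S => S.LeadsIteration x
  | .forth y _ P => y = x ∨ ∃ i, (P i).LeadsIteration x
  | .back y _ P => y = x ∨ ∃ i, (P i).LeadsIteration x

/-- Every register leading a selection or an iteration is read-only in its bodies. -/
def Safe.LeadersReadOnly : Safe R → Prop
  | .atom _ => True
  | .seq S₁ S₂ => S₁.LeadersReadOnly ∧ S₂.LeadersReadOnly
  | .cond x _ S => ¬ S.Writes x ∧ S.LeadersReadOnly
  | .forth x _ P => ∀ i, ¬ (P i).Writes x ∧ (P i).LeadersReadOnly
  | .back x _ P => ∀ i, ¬ (P i).Writes x ∧ (P i).LeadersReadOnly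

/-- The raw term belongs to ForNo: leaders of selections and iterations are read-only in the
bodies, and the registers of a normal block are read-only in its body and are the only ones that
lead iterations there. -/
def Term.IsForNo : Term R → Prop
  | .atom _ => True
  | .seq T₁ T₂ => T₁.IsForNo ∧ T₂.IsForNo
  | .cond x _ T => ¬ T.Writes x ∧ T.IsForNo
  | .normal y ys S => S.LeadersReadOnly ∧ (∀ x ∈ y :: ys, ¬ S.Writes x) ∧
      ∀ x, S.LeadsIteration x → x ∈ y :: ys

/-! ### Operational semantics -/

/-- Stacks of natural numbers; the head of the list is the top. -/
abbrev Stack : Type := List ℕ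

/-- A state is a store together with the error counter. -/
abbrev State (R : Type u) : Type u := (R → Stack) × ℕ

/-- Push `n` if the counter is `0`; otherwise undo one failed `pop n` by decrementing the counter.
A state with `n` on top and positive counter is not the result of a failed `pop n` and is left
unchanged, as it is by `pop n`. So the two operations are total and inverse to each other. -/
def push (n : ℕ) : Stack × ℕ → Stack × ℕ
  | (s, 0) => (n :: s, 0)
  | (s, c + 1) => if s.head? = some n then (s, c + 1) else (s, c)

/-- Pop `n` if it is on top and the counter is `0`; a `pop n` on a stack whose top is not `n`
fails, which is recorded in the counter. With `n` on top and a positive counter nothing changes. -/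
def pop (n : ℕ) : Stack × ℕ → Stack × ℕ
  | (s, 0) => if s.head? = some n then (s.tail, 0) else (s, 1)
  | (s, c + 1) => if s.head? = some n then (s, c + 1) else (s, c + 2)

theorem pop_push (n : ℕ) (p : Stack × ℕ) : pop n (push n p) = p := by
  obtain ⟨s, _ | c⟩ := p
  · simp [push, pop]
  · by_cases h : s.head? = some n
    · simp [push, pop, h]
    · cases c <;> simp [push, pop, h]

theorem push_pop (n : ℕ) (p : Stack × ℕ) : push n (pop n p) = p := by
  obtain ⟨s, _ | c⟩ := p
  · cases s with
    | nil => simp [push, pop]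
    | cons a t =>
      by_cases h : a = n
      · subst h; simp [push, pop]
      · simp [push, pop, h]
  · by_cases h : s.head? = some n <;> simp [push, pop, h]

variable [DecidableEq R]

/-- Big-step semantics of atomic terms. -/
inductive Atom.Eval : Atom R → State R → State R → Prop
  | skip (ω : State R) : Atom.Eval .skip ω ω
  | push (n : ℕ) (x : R) (φ : R → Stack) (c : ℕ) (s : Stack) (d : ℕ) :
      ForNo.push n (φ x, c) = (s, d) →
      Atom.Eval (.push n x) (φ, c) (Function.update φ x s, d)
  | pop (n : ℕ) (x : R) (φ : R → Stack) (c : ℕ) (s : Stack) (d : ℕ) :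
      ForNo.pop n (φ x, c) = (s, d) →
      Atom.Eval (.pop n x) (φ, c) (Function.update φ x s, d)

mutual

/-- Big-step semantics of safe terms. -/
inductive Safe.Eval : Safe R → State R → State R → Prop
  | atom (a : Atom R) (ω ω₁ : State R) : Atom.Eval a ω ω₁ → Safe.Eval (.atom a) ω ω₁
  | seq (S₁ S₂ : Safe R) (ω ω₁ ω₂ : State R) :
      Safe.Eval S₁ ω ω₁ → Safe.Eval S₂ ω₁ ω₂ → Safe.Eval (.seq S₁ S₂) ω ω₂
  | cond_eq (x : R) (n : ℕ) (S : Safe R) (ω ω₁ : State R) :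
      (ω.1 x).head? = some n → Safe.Eval S ω ω₁ → Safe.Eval (.cond x n S) ω ω₁
  | cond_neq (x : R) (n : ℕ) (S : Safe R) (ω : State R) :
      (ω.1 x).head? ≠ some n → Safe.Eval (.cond x n S) ω ω
  | forth (x : R) (n : ℕ) (P : Fin (n + 1) → Safe R) (ω ω₁ : State R) :
      Safe.Iter (ω.1 x) n P ω ω₁ → Safe.Eval (.forth x n P) ω ω₁
  | back (x : R) (n : ℕ) (P : Fin (n + 1) → Safe R) (ω ω₁ : State R) :
      Safe.Iter (ω.1 x).reverse n P ω ω₁ → Safe.Eval (.back x n P) ω ω₁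

/-- Unfolding of an iteration over a stack: the entry `i` selects the body `P (min i n)`. -/
inductive Safe.Iter : Stack → (n : ℕ) → (Fin (n + 1) → Safe R) → State R → State R → Prop
  | base (n : ℕ) (P : Fin (n + 1) → Safe R) (ω : State R) : Safe.Iter [] n P ω ω
  | step (i : ℕ) (t : Stack) (n : ℕ) (P : Fin (n + 1) → Safe R) (ω ω₁ ω₂ : State R) :
      Safe.Eval (P ⟨min i n, Nat.lt_succ_of_le (Nat.min_le_right i n)⟩) ω ω₁ →
      Safe.Iter t n P ω₁ ω₂ → Safe.Iter (i :: t) n P ω ω₂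

end

/-- Big-step semantics of raw terms. -/
inductive Term.Eval : Term R → State R → State R → Prop
  | atom (a : Atom R) (ω ω₁ : State R) : Atom.Eval a ω ω₁ → Term.Eval (.atom a) ω ω₁
  | seq (T₁ T₂ : Term R) (ω ω₁ ω₂ : State R) :
      Term.Eval T₁ ω ω₁ → Term.Eval T₂ ω₁ ω₂ → Term.Eval (.seq T₁ T₂) ω ω₂
  | cond_eq (x : R) (n : ℕ) (T : Term R) (ω ω₁ : State R) :
      (ω.1 x).head? = some n → Term.Eval T ω ω₁ → Term.Eval (.cond x n T) ω ω₁
  | cond_neq (x : R) (n : ℕ) (T : Term R) (ω : State R) :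
      (ω.1 x).head? ≠ some n → Term.Eval (.cond x n T) ω ω
  | normal (y : R) (ys : List R) (S : Safe R) (ω ω₁ : State R) :
      Safe.Eval S ω ω₁ → Term.Eval (.normal y ys S) ω ω₁

/-- The stack encoding a string, for a bijection of the alphabet with `{0, …, |A| - 1}`. -/
def encode {A : Type v} [Fintype A] (e : A ≃ Fin (Fintype.card A)) (w : List A) : Stack :=
  w.map fun a => (e a : ℕ)

/-- `T` computes `f`: for some encoding and some registers `inp` and `out`, evaluating `T` from
the sound state in which `inp` holds the input and all other registers are empty ends in a sound
state in which `out` holds the value of `f`. -/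
def Term.Computes {A : Type v} [Fintype A] (T : Term R) (f : List A → List A) : Prop :=
  ∃ (e : A ≃ Fin (Fintype.card A)) (inp out : R), ∀ w : List A, ∃ φ : R → Stack,
    T.Eval (Function.update (fun _ => []) inp (encode e w), 0) (φ, 0) ∧ φ out = encode e (f w)

end ForNo

/-! ### Polynomial-time Turing machines -/

namespace SingleTape

universe u

inductive Dir : Type
  | left
  | right

/-- A deterministic Turing machine with input/output alphabet `A`. -/
structure Machine (A : Type u) where
  /-- states -/
  Q : Type
  finQ : Finite Q
  q₀ : Q
  qHalt : Q
  /-- tape alphabet -/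
  Γ : Type u
  finΓ : Finite Γ
  /-- the inclusion of `A` into the tape alphabet -/
  incl : A ↪ Γ
  blank : Γ
  blank_notMem : blank ∉ Set.range incl
  δ : {q : Q // q ≠ qHalt} → Γ → Q × Γ × Dir

namespace Machine

variable {A : Type u}

/-- A configuration: state, contents of the semi-infinite tape, and position of the head. -/
@[ext] structure Cfg (M : Machine A) where
  state : M.Q
  tape : ℕ → M.Γ
  head : ℕ

/-- Position of the head after a move; a left move on the leftmost cell has no effect. -/
def move : Dir → ℕ → ℕ
  | .left, i => i - 1
  | .right, i => i + 1

/-- The configuration yielded by a transition from the configuration `c`, which is not halting. -/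
def next (M : Machine A) (c : M.Cfg) (h : c.state ≠ M.qHalt) : M.Cfg where
  state := (M.δ ⟨c.state, h⟩ (c.tape c.head)).1
  tape := Function.update c.tape c.head (M.δ ⟨c.state, h⟩ (c.tape c.head)).2.1
  head := move (M.δ ⟨c.state, h⟩ (c.tape c.head)).2.2 c.head

/-- `M.Yields k c d`: the machine goes from `c` to `d` in exactly `k` transitions. -/
inductive Yields (M : Machine A) : ℕ → M.Cfg → M.Cfg → Prop
  | refl (c : M.Cfg) : Yields M 0 c c
  | step (k : ℕ) (c d : M.Cfg) (h : c.state ≠ M.qHalt) :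
      Yields M k (M.next c h) d → Yields M (k + 1) c d

/-- The configuration in state `q` with only `w` on the tape (all other cells are blank) and the
head on the leftmost cell. -/
def cfgOf (M : Machine A) (q : M.Q) (w : List A) : M.Cfg where
  state := q
  tape := fun i => ((w.map M.incl)[i]?).getD M.blank
  head := 0

end Machine

/-- `f` is in FPTIME: some Turing machine, started on any string `w`, halts within a number of
steps polynomial in the length of `w`, with only `f w` on the tape and the head on the leftmost
cell. -/
def FPTIME {A : Type u} (f : List A → List A) : Prop :=
  ∃ (M : Machine A) (p : Polynomial ℕ), ∀ w : List A, ∃ k ≤ p.eval w.length,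
    M.Yields k (M.cfgOf M.q₀ w) (M.cfgOf M.qHalt (f w))

end SingleTape

-- Inside a normal block, iterations are led only by registers that the block never writes, so the
-- lengths of these registers stay fixed while it runs. If they are at most `ℓ`, every iteration
-- evaluates at most `ℓ` bodies, and nesting multiplies such bounds. By induction on the safe term,
-- its cost is a polynomial in `ℓ`, however long the written registers become
-- (`Safe.exists_stackProg`, resting on `Safe.Eval.eq_of_not_writes`). Outside blocks nothing is
-- repeated. A run of `n` steps lengthens a register by at most `n`, so the second part of a
-- sequence starts on polynomially long registers, and the bounds compose, once for each sequencing
-- in the term (`Term.exists_stackProg`).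
--
-- Cost is measured on programs for finitely many stacks over a finite alphabet. This suffices
-- because a term mentions finitely many registers and constants: entries from a large `B` on behave
-- alike, since selections compare with numbers below `B` and the choice of a body truncates at some
-- `n ≤ B`. The counter is a stack in unary, and pending iterations share one auxiliary stack,
-- divided by separators.
--
-- A stack program runs on one tape with a track per stack. A basic operation is a trip of the head
-- to the top of a stack and back, linear in a height that is itself bounded by input length plus
-- running time, so the slowdown is polynomial (`StackProg.Exec.toProg`). Structured tape programs
-- become finite controls by `Prog.Exec.reach`.

namespace SingleTape

open Function

/-! ### Structured programs for a single tape -/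

/-- A part of a machine with one exit, which is represented by `none`. -/
structure Frag (Γ : Type) where
  Q : Type
  finQ : Finite Q
  start : Q
  δ : Q → Γ → Option Q × Γ × Dir

namespace Frag

variable {Γ : Type}

/-- `F.Reach o c n o' c'`: from the control state `o` and the tape and head position `c`, the
fragment reaches `o'` and `c'` in exactly `n` transitions. -/
inductive Reach (F : Frag Γ) :
    Option F.Q → (ℕ → Γ) × ℕ → ℕ → Option F.Q → (ℕ → Γ) × ℕ → Prop
  | refl (o : Option F.Q) (c : (ℕ → Γ) × ℕ) : Reach F o c 0 o c
  | step (q : F.Q) (t : ℕ → Γ) (h n : ℕ) (o' : Option F.Q) (c' : (ℕ → Γ) × ℕ) :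
      Reach F (F.δ q (t h)).1
        (update t h (F.δ q (t h)).2.1, Machine.move (F.δ q (t h)).2.2 h) n o' c' →
      Reach F (some q) (t, h) (n + 1) o' c'

theorem Reach.trans {F : Frag Γ} {o₁ o₂ o₃ : Option F.Q} {c₁ c₂ c₃ : (ℕ → Γ) × ℕ} {m n : ℕ}
    (h₁ : F.Reach o₁ c₁ m o₂ c₂) (h₂ : F.Reach o₂ c₂ n o₃ c₃) :
    F.Reach o₁ c₁ (m + n) o₃ c₃ := by
  induction h₁ with
  | refl => simpa using h₂
  | step q t h k o' c' _ ih =>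
    rw [Nat.add_right_comm]
    exact .step q t h _ _ _ (ih h₂)

/-- A move to the right and back that keeps the tape. -/
theorem Reach.stay {F : Frag Γ} {q q' : F.Q} {t : ℕ → Γ} {h : ℕ} {o : Option F.Q}
    (hq : F.δ q (t h) = (some q', t h, .right)) (hq' : ∀ a, F.δ q' a = (o, a, .left)) :
    F.Reach (some q) (t, h) 2 o (t, h) := by
  refine .step q t h 1 _ _ ?_
  rw [hq, update_eq_self]
  refine .step q' t (h + 1) 0 _ _ ?_
  rw [hq', update_eq_self]
  exact .refl _ _

/-- Runs are carried over by a map of control states that commutes with the transitions. -/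
theorem Reach.map {F G : Frag Γ} (φ : Option F.Q → Option G.Q)
    (hφ : ∀ q, ∃ q', φ (some q) = some q' ∧ ∀ g, G.δ q' g = (φ (F.δ q g).1, (F.δ q g).2))
    {o o' : Option F.Q} {c c' : (ℕ → Γ) × ℕ} {n : ℕ} (h : F.Reach o c n o' c') :
    G.Reach (φ o) c n (φ o') c' := by
  induction h with
  | refl => exact .refl _ _
  | step q t h k o' c' _ ih =>
    obtain ⟨q', hq', hδ⟩ := hφ q
    rw [hq']
    refine .step q' t h _ _ _ ?_
    rw [hδ]
    exact ih

/-- The fragment consisting of one transition. -/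
def act (g : Γ → Γ) (d : Dir) : Frag Γ where
  Q := Unit
  finQ := inferInstance
  start := ()
  δ _ a := (none, g a, d)

/-- Sequential composition. -/
def seq (F G : Frag Γ) : Frag Γ where
  Q := F.Q ⊕ G.Q
  finQ := have := F.finQ; have := G.finQ; inferInstance
  start := .inl F.start
  δ
    | .inl q, a => (some ((F.δ q a).1.elim (.inr G.start) .inl), (F.δ q a).2)
    | .inr q, a => ((G.δ q a).1.map .inr, (G.δ q a).2)

/-- Case distinction on the symbol read. The head has to move, hence moves right and back. -/
def switch [Finite Γ] (F : Γ → Frag Γ) : Frag Γ where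
  Q := Option Γ ⊕ (Σ a, (F a).Q)
  finQ := have := fun a => (F a).finQ; inferInstance
  start := .inl none
  δ
    | .inl none, a => (some (.inl (some a)), a, .right)
    | .inl (some b), a => (some (.inr ⟨b, (F b).start⟩), a, .left)
    | .inr ⟨b, q⟩, a => (((F b).δ q a).1.map fun q' => .inr ⟨b, q'⟩, ((F b).δ q a).2)

/-- Iteration as long as the symbol read has the property `p`. -/
def loop (p : Γ → Bool) (F : Frag Γ) : Frag Γ where
  Q := Option Bool ⊕ F.Q
  finQ := have := F.finQ; inferInstance
  start := .inl none
  δ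
    | .inl none, a => (some (.inl (some (p a))), a, .right)
    | .inl (some b), a => (if b then some (.inr F.start) else none, a, .left)
    | .inr q, a => (some ((F.δ q a).1.elim (.inl none) .inr), (F.δ q a).2)

end Frag

/-- Structured programs for a tape with symbols `Γ`. -/
inductive Prog (Γ : Type) : Type
  | act (g : Γ → Γ) (d : Dir) : Prog Γ
  | seq (P Q : Prog Γ) : Prog Γ
  | switch (P : Γ → Prog Γ) : Prog Γ
  | loop (p : Γ → Bool) (P : Prog Γ) : Prog Γ

namespace Prog

variable {Γ : Type}

/-- Big-step semantics with the number of transitions of the corresponding machine. -/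
inductive Exec : Prog Γ → (ℕ → Γ) × ℕ → ℕ → (ℕ → Γ) × ℕ → Prop
  | act (g : Γ → Γ) (d : Dir) (t : ℕ → Γ) (h : ℕ) :
      Exec (.act g d) (t, h) 1 (update t h (g (t h)), Machine.move d h)
  | seq {P Q : Prog Γ} {c c₁ c₂ : (ℕ → Γ) × ℕ} {m n : ℕ} :
      Exec P c m c₁ → Exec Q c₁ n c₂ → Exec (.seq P Q) c (m + n) c₂
  | switch {P : Γ → Prog Γ} {t : ℕ → Γ} {h n : ℕ} {c : (ℕ → Γ) × ℕ} :
      Exec (P (t h)) (t, h) n c → Exec (.switch P) (t, h) (2 + n) c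
  | loop_done {p : Γ → Bool} (P : Prog Γ) {t : ℕ → Γ} {h : ℕ} :
      p (t h) = false → Exec (.loop p P) (t, h) 2 (t, h)
  | loop_step {p : Γ → Bool} {P : Prog Γ} {t : ℕ → Γ} {h m n : ℕ} {c₁ c₂ : (ℕ → Γ) × ℕ} :
      p (t h) = true → Exec P (t, h) m c₁ → Exec (.loop p P) c₁ n c₂ →
      Exec (.loop p P) (t, h) (2 + m + n) c₂

/-- The fragment executing a program. -/
def frag [Finite Γ] : Prog Γ → Frag Γ
  | act g d => .act g d
  | seq P Q => .seq P.frag Q.frag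
  | switch P => .switch fun a => (P a).frag
  | loop p P => .loop p P.frag

/-- The control states of each part embed into those of the whole, with the exit of the part
redirected to the state where the whole continues. `Reach.map` transports the runs of the parts and
`Reach.trans` joins them. -/
theorem Exec.reach [Finite Γ] {P : Prog Γ} {c c' : (ℕ → Γ) × ℕ} {n : ℕ} (h : P.Exec c n c') :
    P.frag.Reach (some P.frag.start) c n none c' := by
  induction h with
  | act g d t h => exact .step _ t h 0 _ _ (.refl _ _)
  | @seq P Q c c₁ c₂ m n _ _ ih₁ ih₂ =>
    refine .trans (o₂ := some (Sum.inr Q.frag.start)) (c₂ := c₁) ?_ ?_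
    · exact ih₁.map (G := .seq P.frag Q.frag)
        (fun o => some (o.elim (Sum.inr Q.frag.start) Sum.inl)) fun q => ⟨Sum.inl q, rfl, fun _ => rfl⟩
    · exact ih₂.map (G := .seq P.frag Q.frag) (fun o => o.map Sum.inr)
        fun q => ⟨Sum.inr q, rfl, fun _ => rfl⟩
  | @switch P t h n c _ ih =>
    refine .trans (m := 2) (o₂ := some (Sum.inr ⟨t h, (P (t h)).frag.start⟩)) (c₂ := (t, h)) ?_ ?_
    · exact .stay (q' := Sum.inl (some (t h))) rfl fun _ => rfl
    · exact ih.map (G := .switch fun a => (P a).frag) (fun o => o.map fun q => Sum.inr ⟨t h, q⟩)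
        fun q => ⟨Sum.inr ⟨t h, q⟩, rfl, fun _ => rfl⟩
  | @loop_done p P t h hp =>
    refine .stay (q' := Sum.inl (some false)) ?_ fun _ => rfl
    simp [frag, Frag.loop, hp]
  | @loop_step p P t h m n c₁ c₂ hp _ _ ih₁ ih₂ =>
    refine .trans (.trans (o₂ := some (Sum.inr P.frag.start)) (c₂ := (t, h)) ?_ ?_) ih₂
    · refine .stay (q' := Sum.inl (some true)) ?_ fun _ => rfl
      simp [frag, Frag.loop, hp]
    · exact ih₁.map (G := .loop p P.frag) (fun o => some (o.elim (Sum.inl none) Sum.inr))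
        fun q => ⟨Sum.inr q, rfl, fun _ => rfl⟩

end Prog

/-- The machine executing a program, for an inclusion of the alphabet into the tape symbols. -/
def Prog.machine {A : Type*} {Γ : Type} [Finite Γ] (P : Prog Γ) (incl : A ↪ Γ) (blank : Γ)
    (hb : blank ∉ Set.range incl) : Machine A where
  Q := Option P.frag.Q
  finQ := have := P.frag.finQ; inferInstance
  q₀ := some P.frag.start
  qHalt := none
  Γ := ULift Γ
  finΓ := inferInstance
  incl := incl.trans Equiv.ulift.symm.toEmbedding
  blank := ⟨blank⟩
  blank_notMem := by
    rintro ⟨a, ha⟩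
    exact hb ⟨a, congrArg ULift.down ha⟩
  δ q a := (((P.frag.δ (q.1.get (Option.isSome_iff_ne_none.2 q.2)) a.down).1),
    ⟨(P.frag.δ (q.1.get (Option.isSome_iff_ne_none.2 q.2)) a.down).2.1⟩,
    (P.frag.δ (q.1.get (Option.isSome_iff_ne_none.2 q.2)) a.down).2.2)

/-- The exit `none` is the halting state, so transitions correspond one to one. -/
theorem Prog.yields {A : Type*} {Γ : Type} [Finite Γ] (P : Prog Γ) (incl : A ↪ Γ) (blank : Γ)
    (hb : blank ∉ Set.range incl) {o o' : Option P.frag.Q} {c c' : (ℕ → Γ) × ℕ} {n : ℕ}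
    (h : P.frag.Reach o c n o' c') :
    (P.machine incl blank hb).Yields n ⟨o, fun i => ⟨c.1 i⟩, c.2⟩ ⟨o', fun i => ⟨c'.1 i⟩, c'.2⟩ := by
  induction h with
  | refl => exact .refl _
  | step q t h k o' c' _ ih =>
    refine .step _ _ _ (Option.some_ne_none q) ?_
    convert ih using 1
    refine Machine.Cfg.ext rfl ?_ rfl
    funext i
    by_cases hi : i = h
    · subst hi; simp [Machine.next, Prog.machine]
    · simp [Machine.next, Prog.machine, hi]

/-- The tape holding the string `w`. -/
def stringTape {A Γ : Type*} (incl : A → Γ) (blank : Γ) (w : List A) (i : ℕ) : Γ :=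
  ((w.map incl)[i]?).getD blank

/-- A function computed by a program in polynomial time is in FPTIME. -/
theorem Prog.fptime {A : Type*} {Γ : Type} [Finite Γ] (P : Prog Γ) (incl : A ↪ Γ) (blank : Γ)
    (hb : blank ∉ Set.range incl) (f : List A → List A) (p : Polynomial ℕ)
    (h : ∀ w, ∃ n ≤ p.eval w.length,
      P.Exec (stringTape incl blank w, 0) n (stringTape incl blank (f w), 0)) : FPTIME f := by
  refine ⟨P.machine incl blank hb, p, fun w => ?_⟩
  obtain ⟨n, hn, hP⟩ := h w
  refine ⟨n, hn, ?_⟩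
  have key : ∀ q v, (P.machine incl blank hb).cfgOf q v =
      ⟨q, fun i => ⟨stringTape incl blank v i⟩, 0⟩ := by
    intro q v
    refine Machine.Cfg.ext rfl ?_ rfl
    funext i
    change ((v.map (incl.trans Equiv.ulift.symm.toEmbedding))[i]?).getD ⟨blank⟩ = _
    simp only [stringTape, List.getElem?_map]
    cases v[i]? <;> rfl
  rw [key, key]
  exact P.yields incl blank hb hP.reach

end SingleTape

namespace SingleTape

open Function

/-! ### Programs for finitely many stacks -/

/-- Structured programs for stacks with entries in `V`, indexed by `K`. -/
inductive StackProg (K V : Type) : Type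
  | skip : StackProg K V
  | push (k : K) (v : V) : StackProg K V
  | pop (k : K) : StackProg K V
  | seq (P Q : StackProg K V) : StackProg K V
  | case (k : K) (P : Option V → StackProg K V) : StackProg K V
  | loop (k : K) (p : Option V → Bool) (P : StackProg K V) : StackProg K V

namespace StackProg

variable {K V : Type} [DecidableEq K]

/-- Big-step semantics with the number of basic operations and tests. -/
inductive Exec : StackProg K V → (K → List V) → ℕ → (K → List V) → Prop
  | skip (σ : K → List V) : Exec .skip σ 1 σ
  | push (k : K) (v : V) (σ : K → List V) : Exec (.push k v) σ 1 (update σ k (v :: σ k))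
  | pop (k : K) (σ : K → List V) : Exec (.pop k) σ 1 (update σ k (σ k).tail)
  | seq {P Q : StackProg K V} {σ σ₁ σ₂ : K → List V} {m n : ℕ} :
      Exec P σ m σ₁ → Exec Q σ₁ n σ₂ → Exec (.seq P Q) σ (m + n) σ₂
  | case {k : K} {P : Option V → StackProg K V} {σ σ₁ : K → List V} {n : ℕ} :
      Exec (P (σ k).head?) σ n σ₁ → Exec (.case k P) σ (n + 1) σ₁
  | loop_done {k : K} {p : Option V → Bool} (P : StackProg K V) {σ : K → List V} :
      p (σ k).head? = false → Exec (.loop k p P) σ 1 σ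
  | loop_step {k : K} {p : Option V → Bool} {P : StackProg K V} {σ σ₁ σ₂ : K → List V}
      {m n : ℕ} : p (σ k).head? = true → Exec P σ m σ₁ → Exec (.loop k p P) σ₁ n σ₂ →
      Exec (.loop k p P) σ (m + n + 1) σ₂

/-- Time bounds space: a basic operation pushes at most one entry. -/
theorem Exec.length_le {P : StackProg K V} {σ σ' : K → List V} {n : ℕ} (h : P.Exec σ n σ')
    (j : K) : (σ' j).length ≤ (σ j).length + n := by
  induction h with
  | skip => omega
  | push k v σ =>
    by_cases hj : j = k
    · subst hj; simp
    · simp [hj]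
  | pop k σ =>
    by_cases hj : j = k
    · subst hj; simp; omega
    · simp [hj]
  | seq => omega
  | case => omega
  | loop_done => omega
  | loop_step => omega

end StackProg

/-- Tape symbols with one track for each stack; the Boolean marks the leftmost cell. -/
abbrev Cell (K V : Type) : Type := Bool × (K → Option V)

-- Stacks as tracks of a tape

namespace Cell

variable {K V : Type}

/-- The tape representing stacks: bottom entries are in the leftmost cell. -/
def tape (σ : K → List V) (i : ℕ) : Cell K V := (decide (i = 0), fun k => (σ k).reverse[i]?)

/-- This includes the empty stack: truncated subtraction gives cell `0`, whose track is then empty.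
-/
theorem tape_top (σ : K → List V) (k : K) :
    (tape σ ((σ k).length - 1)).2 k = (σ k).head? := by
  rcases hs : σ k with _ | ⟨v, s⟩ <;> simp [tape, hs]

variable [DecidableEq K]

/-- Write `o` on the track `k`. -/
def set (k : K) (o : Option V) (g : Cell K V) : Cell K V := (g.1, update g.2 k o)

/-- Remove the mark and all tracks but `k`. -/
def only (k : K) (g : Cell K V) : Cell K V := (false, update (fun _ => none) k (g.2 k))

theorem tape_push (σ : K → List V) (k : K) (v : V) :
    update (tape σ) (σ k).length (set k (some v) (tape σ (σ k).length)) =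
      tape (update σ k (v :: σ k)) := by
  funext i
  refine Prod.ext ?_ (funext fun j => ?_)
  · by_cases hi : i = (σ k).length
    · subst hi; simp [set, tape]
    · simp [hi, tape]
  · by_cases hj : j = k
    · subst hj
      by_cases hi : i = (σ j).length
      · subst hi; simp [set, tape]
      · have : (σ j).reverse[i]? = ((σ j).reverse ++ [v])[i]? := by
          rcases lt_or_gt_of_ne hi with h | h
          · rw [List.getElem?_append_left (by simpa using h)]
          · rw [List.getElem?_eq_none (by simp; omega), List.getElem?_eq_none (by simp; omega)]
        simp [hi, tape, this]
    · by_cases hi : i = (σ k).length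
      · subst hi; simp [set, tape, hj]
      · simp [hi, tape, hj]

theorem tape_pop (σ : K → List V) (k : K) :
    update (tape σ) ((σ k).length - 1) (set k none (tape σ ((σ k).length - 1))) =
      tape (update σ k (σ k).tail) := by
  funext i
  refine Prod.ext ?_ (funext fun j => ?_)
  · by_cases hi : i = (σ k).length - 1
    · subst hi; simp [set, tape]
    · simp [hi, tape]
  · by_cases hj : j = k
    · subst hj
      by_cases hi : i = (σ j).length - 1
      · subst hi; simp [set, tape]
      · rcases hs : σ j with _ | ⟨v, s⟩
        · simp [hs] at hi
          simp [hi, tape, hs]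
        · simp [hs] at hi
          have : s.reverse[i]? = (s.reverse ++ [v])[i]? := by
            rcases lt_or_gt_of_ne hi with h | h
            · rw [List.getElem?_append_left (by simpa using h)]
            · rw [List.getElem?_eq_none (by simp; omega), List.getElem?_eq_none (by simp; omega)]
          simp [hi, tape, this, hs]
    · by_cases hi : i = (σ k).length - 1
      · subst hi; simp [set, tape, hj]
      · simp [hi, tape, hj]

end Cell

-- Head movements on the tape

namespace Prog

variable {K V : Type}

/-- Move to the right over the symbols with the property `p`. -/
def scan {Γ : Type} (p : Γ → Bool) : Prog Γ := .loop p (.act id .right)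

/-- Move to the leftmost cell, modifying the other ones. -/
def sweep (g : Cell K V → Cell K V) : Prog (Cell K V) := .loop (fun a => !a.1) (.act g .left)

/-- Move to the top entry of a stack. -/
def top (k : K) : Prog (Cell K V) := .seq (scan fun a => (a.2 k).isSome) (.act id .left)

/-- Each cell costs two transitions for the test and one for the move; the failing test at the end
costs two more. -/
theorem exec_scan {Γ : Type} (p : Γ → Bool) (t : ℕ → Γ) (n : ℕ) (hn : p (t n) = false) :
    ∀ m h, h + m = n → (∀ i < n, p (t i) = true) → (scan p).Exec (t, h) (3 * m + 2) (t, n) := by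
  intro m
  induction m with
  | zero => rintro h rfl _; exact .loop_done _ hn
  | succ m ih =>
    intro h hm hp
    have h₁ := Exec.act id .right t h
    rw [id, update_eq_self] at h₁
    rw [show 3 * (m + 1) + 2 = 2 + 1 + (3 * m + 2) by ring]
    exact .loop_step (hp h (by omega)) h₁ (ih (h + 1) (by omega) hp)

theorem exec_sweep (g : Cell K V → Cell K V) (h : ℕ) : ∀ t : ℕ → Cell K V,
    (∀ i, (t i).1 = decide (i = 0)) → (sweep g).Exec (t, h) (3 * h + 2)
      (fun i => if 0 < i ∧ i ≤ h then g (t i) else t i, 0) := by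
  have done : ∀ t : ℕ → Cell K V, (t 0).1 = true → (sweep g).Exec (t, 0) 2 (t, 0) :=
    fun t ht => .loop_done _ (by simp [ht])
  -- The hypothesis on marks is weakened to the cells up to the head, because `g` may alter the
  -- marks of the cells already passed.
  suffices H : ∀ t : ℕ → Cell K V, (t 0).1 = true → (∀ i ≤ h, i ≠ 0 → (t i).1 = false) →
      (sweep g).Exec (t, h) (3 * h + 2) (fun i => if 0 < i ∧ i ≤ h then g (t i) else t i, 0) from
    fun t ht => H t (by simp [ht]) fun i _ hi => by simp [ht, hi]
  induction h with
  | zero =>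
    intro t ht _
    convert done t ht using 3 with i
    rw [if_neg (by omega)]
  | succ h ih =>
    intro t ht hf
    have h₁ := Exec.act g .left t (h + 1)
    have h₂ := ih (update t (h + 1) (g (t (h + 1)))) (by simpa using ht) (fun i hi hi' => by
      rw [update_of_ne (by omega)]
      exact hf i (by omega) hi')
    have := Exec.loop_step (p := fun a : Cell K V => !a.1) (by simp [hf]) h₁ h₂
    rw [show 3 * (h + 1) + 2 = 2 + 1 + (3 * h + 2) by ring]
    change (sweep g).Exec _ _ _ at this
    convert this using 1
    rw [Prod.mk.injEq]
    refine ⟨?_, rfl⟩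
    funext i
    by_cases hi : i = h + 1
    · subst hi; simp
    · have : (0 < i ∧ i ≤ h + 1) ↔ (0 < i ∧ i ≤ h) := by omega
      simp only [update_of_ne hi, this]

theorem exec_home (σ : K → List V) (h : ℕ) :
    (sweep id).Exec (Cell.tape σ, h) (3 * h + 2) (Cell.tape σ, 0) := by
  have := exec_sweep id h (Cell.tape σ) fun _ => rfl
  simpa using this

theorem exec_scan_stack (σ : K → List V) (k : K) :
    (scan fun a : Cell K V => (a.2 k).isSome).Exec (Cell.tape σ, 0) (3 * (σ k).length + 2)
      (Cell.tape σ, (σ k).length) := by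
  refine exec_scan _ _ _ ?_ _ _ (Nat.zero_add _) ?_
  · simp [Cell.tape]
  · intro i hi
    simp [Cell.tape, hi]

/-- On an empty stack the final left move starts in cell `0` and has no effect, in agreement with
truncated subtraction. -/
theorem exec_top (σ : K → List V) (k : K) :
    (top k).Exec (Cell.tape σ, 0) (3 * (σ k).length + 3) (Cell.tape σ, (σ k).length - 1) := by
  have h₁ := Exec.act id .left (Cell.tape σ) (σ k).length
  rw [id, update_eq_self] at h₁
  have := Exec.seq (exec_scan_stack σ k) h₁
  exact this

end Prog

-- Simulation of stack programs on the tape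

namespace StackProg

variable {K V : Type} [DecidableEq K]

/-- The single-tape program that simulates a program for stacks. The head returns to the leftmost
cell after each operation. -/
def toProg : StackProg K V → Prog (Cell K V)
  | skip => .act id .left
  | push k v => .seq (.scan fun a => (a.2 k).isSome)
      (.seq (.act (Cell.set k (some v)) .left) (.sweep id))
  | pop k => .seq (.top k) (.seq (.act (Cell.set k none) .left) (.sweep id))
  | seq P Q => .seq P.toProg Q.toProg
  | case k P => .seq (.top k) (.switch fun a => .seq (.sweep id) (P (a.2 k)).toProg)
  | loop k p P => .seq (.top k) (.seq
      (.loop (fun a => p (a.2 k)) (.seq (.sweep id) (.seq P.toProg (.top k)))) (.sweep id))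

/-- The number `N` bounds height plus remaining time, a quantity that no step increases, so it
serves for all parts of the run. A walk to the top of a stack and back then takes at most `6 * N +
7` transitions, tests included. -/
theorem Exec.toProg {P : StackProg K V} {σ σ' : K → List V} {n : ℕ} (h : P.Exec σ n σ') (N : ℕ)
    (hN : ∀ k, (σ k).length + n ≤ N) : ∃ t ≤ n * (6 * N + 7),
      P.toProg.Exec (Cell.tape σ, 0) t (Cell.tape σ', 0) := by
  induction h with
  | skip σ =>
    have := Prog.Exec.act id .left (Cell.tape σ) 0
    rw [id, update_eq_self] at this
    exact ⟨1, by omega, this⟩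
  | push k v σ =>
    have h₁ := Prog.Exec.act (Cell.set k (some v)) .left (Cell.tape σ) (σ k).length
    rw [Cell.tape_push] at h₁
    have := hN k
    refine ⟨_, ?_, .seq (Prog.exec_scan_stack σ k) (.seq h₁ (Prog.exec_home _ _))⟩
    dsimp only [Machine.move]
    omega
  | pop k σ =>
    have h₁ := Prog.Exec.act (Cell.set k none) .left (Cell.tape σ) ((σ k).length - 1)
    rw [Cell.tape_pop] at h₁
    have := hN k
    refine ⟨_, ?_, .seq (Prog.exec_top σ k) (.seq h₁ (Prog.exec_home _ _))⟩
    dsimp only [Machine.move]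
    omega
  | @seq P Q σ σ₁ σ₂ m n h₁ _ ih₁ ih₂ =>
    obtain ⟨t₁, ht₁, e₁⟩ := ih₁ fun k => by have := hN k; omega
    obtain ⟨t₂, ht₂, e₂⟩ := ih₂ fun k => by have := hN k; have := h₁.length_le k; omega
    exact ⟨_, by rw [add_mul]; omega, .seq e₁ e₂⟩
  | @case k P σ σ₁ n _ ih =>
    obtain ⟨t, ht, e⟩ := ih fun k => by have := hN k; omega
    have := hN k
    refine ⟨_, ?_, .seq (Prog.exec_top σ k) (.switch (.seq (Prog.exec_home σ _)
      (by rw [Cell.tape_top]; exact e)))⟩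
    rw [add_mul]
    omega
  | @loop_done k p P σ hp =>
    have := hN k
    refine ⟨_, ?_, .seq (Prog.exec_top σ k) (.seq
      (.loop_done _ (by rw [Cell.tape_top]; exact hp)) (Prog.exec_home σ _))⟩
    omega
  | @loop_step k p P σ σ₁ σ₂ m n hp h₁ _ ih₁ ih₂ =>
    obtain ⟨t₁, ht₁, e₁⟩ := ih₁ fun k => by have := hN k; omega
    obtain ⟨t₂, ht₂, e₂⟩ := ih₂ fun k => by have := hN k; have := h₁.length_le k; omega
    -- The simulation of the remaining loop splits into the walk to the top, the tape loop, and the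
    -- return. The walk becomes the end of the first pass through the body, which itself ends with
    -- `top k`.
    rcases e₂ with _ | ⟨d₁, _ | ⟨d₂, d₃⟩⟩
    have := hN k
    refine ⟨_, ?_, .seq (Prog.exec_top σ k) (.seq
      (.loop_step (by rw [Cell.tape_top]; exact hp)
        (.seq (Prog.exec_home σ _) (.seq e₁ d₁)) d₂) d₃)⟩
    rw [add_mul, add_mul]
    omega

open Classical in
/-- Clear the tape except for the track `k`, and return to the leftmost cell. -/
noncomputable def finish (k : K) : Prog (Cell K V) :=
  .seq (.scan fun a => decide (a ≠ (false, fun _ => none))) (.seq (.act id .left)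
    (.seq (.sweep (Cell.only k)) (.act (Cell.only k) .left)))

theorem exec_finish (k : K) (σ : K → List V) (N : ℕ) (hN : ∀ j, (σ j).length ≤ N) :
    ∃ t ≤ 6 * N + 12, (finish k).Exec (Cell.tape σ, 0) t
      (fun i => Cell.only k (Cell.tape σ i), 0) := by
  classical
  have hex : ∃ i, Cell.tape σ i = (false, fun _ => none) := by
    refine ⟨N + 1, Prod.ext (by simp [Cell.tape]) (funext fun j => ?_)⟩
    have := hN j
    simp [Cell.tape]
    omega
  obtain ⟨M, hM, hlt, hle⟩ : ∃ M, Cell.tape σ M = (false, fun _ => none) ∧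
      (∀ i < M, Cell.tape σ i ≠ (false, fun _ => none)) ∧ M ≤ N + 1 := by
    -- `M` is the first blank cell. Tracks have no gaps, so all stacks lie to its left; it is not
    -- cell `0`, which is marked.
    refine ⟨Nat.find hex, Nat.find_spec hex, fun i hi => Nat.find_min hex hi,
      Nat.find_min' hex (Prod.ext (by simp [Cell.tape]) (funext fun j => ?_))⟩
    have := hN j
    simp [Cell.tape]
    omega
  have hM0 : M ≠ 0 := by
    rintro rfl
    simp [Cell.tape] at hM
  have hlen : ∀ j, (σ j).length ≤ M := by
    intro j
    have := congrFun (congrArg Prod.snd hM) j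
    simpa [Cell.tape] using this
  have e₁ := Prog.exec_scan (fun a : Cell K V => decide (a ≠ (false, fun _ => none)))
    (Cell.tape σ) M (by simp [hM]) M 0 (by omega) (fun i hi => by simpa using hlt i hi)
  have e₂ := Prog.Exec.act id .left (Cell.tape σ) M
  rw [id, update_eq_self] at e₂
  -- The sweep leaves cell `0` unchanged, since its mark stops the loop; the last action cleans that
  -- cell, and its left move keeps the head there.
  have e₃ := Prog.exec_sweep (Cell.only k) (M - 1) (Cell.tape σ) fun _ => rfl
  have e₄ := Prog.Exec.act (Cell.only k) .left
    (fun i => if 0 < i ∧ i ≤ M - 1 then Cell.only k (Cell.tape σ i) else Cell.tape σ i) 0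
  refine ⟨3 * M + 2 + (1 + (3 * (M - 1) + 2 + 1)), by omega, .seq e₁ (.seq e₂ (.seq e₃ ?_))⟩
  · convert e₄ using 1
    refine Prod.ext (funext fun i => ?_) rfl
    rcases Nat.eq_zero_or_pos i with rfl | hi
    · simp
    · dsimp only
      rw [update_of_ne hi.ne']
      split_ifs with h
      · rfl
      · have hnone : ∀ j, (σ j).reverse[i]? = none := fun j => by
          have := hlen j
          simp
          omega
        refine Prod.ext ?_ (funext fun j => ?_)
        · simp [Cell.only, Cell.tape, hi.ne']
        · by_cases hj : j = k
          · subst hj; simp [Cell.only, Cell.tape]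
          · rw [Cell.only]
            simp only [update_of_ne hj]
            exact (hnone j).symm

/-- A function computed by a program for stacks in polynomial time is in FPTIME. -/
theorem fptime {A : Type*} [Finite K] [Finite V] (P : StackProg K V) (k : K) (letter : A ↪ V)
    (f : List A → List A) (p : Polynomial ℕ)
    (h : ∀ w, ∃ n ≤ p.eval w.length, ∃ σ : K → List V,
      P.Exec (update (fun _ => []) k (w.map letter).reverse) n σ ∧
        σ k = ((f w).map letter).reverse) : FPTIME f := by
  let incl : A ↪ Cell K V := ⟨fun a => (false, update (fun _ => none) k (some (letter a))), by
    intro a b hab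
    have := congrFun (congrArg Prod.snd hab) k
    simpa using this⟩
  let mark : Prog (Cell K V) := .act (fun a => (true, a.2)) .left
  refine Prog.fptime (.seq mark (.seq P.toProg (finish k))) incl (false, fun _ => none) ?_ f
    -- One transition for the mark, then `p` operations at the rate of `Exec.toProg` and the final
    -- cleaning, both with `N = |w| + p(|w|)`.
    (1 + (p * (6 * (Polynomial.X + p) + 7) + (6 * (Polynomial.X + p) + 12))) fun w => ?_
  · rintro ⟨a, ha⟩
    have := congrFun (congrArg Prod.snd ha) k
    change update (fun _ => none) k (some (letter a)) k = none at this
    simp at this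
  have tape_only : ∀ (σ : K → List V) (v : List A), σ k = (v.map letter).reverse →
      (fun i => Cell.only k (Cell.tape σ i)) = stringTape incl (false, fun _ => none) v := by
    intro σ v hσ
    funext i
    simp only [Cell.only, Cell.tape, hσ, List.reverse_reverse, stringTape, List.getElem?_map]
    cases v[i]? with
    | none => simp
    | some a => rfl
  obtain ⟨n, hn, σ, hσ, hk⟩ := h w
  have hlen : ∀ j, ((update (fun _ => []) k (w.map letter).reverse : K → List V) j).length + n ≤
      w.length + p.eval w.length := by
    intro j
    by_cases hj : j = k
    · subst hj; simpa using hn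
    · simp [hj]; omega
  obtain ⟨t₁, ht₁, e₁⟩ := hσ.toProg _ hlen
  obtain ⟨t₂, ht₂, e₂⟩ := exec_finish k σ (w.length + p.eval w.length)
    fun j => (hσ.length_le j).trans (hlen j)
  rw [tape_only σ (f w) hk] at e₂
  refine ⟨1 + (t₁ + t₂), ?_, .seq ?_ (.seq e₁ e₂)⟩
  · have := Nat.mul_le_mul_right (6 * (w.length + p.eval w.length) + 7) hn
    simp only [Polynomial.eval_add, Polynomial.eval_mul, Polynomial.eval_X, Polynomial.eval_one,
      Polynomial.eval_ofNat]
    omega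
  · convert Prog.Exec.act (fun a : Cell K V => (true, a.2)) .left
      (stringTape incl (false, fun _ => none) w) 0 using 1
    refine Prod.ext (funext fun i => ?_) rfl
    rw [← tape_only (update (fun _ => []) k (w.map letter).reverse) w (by simp)]
    have : ∀ i, (Cell.tape (update (fun _ => []) k (w.map letter).reverse) i).2 =
        (Cell.only k (Cell.tape (update (fun _ => []) k (w.map letter).reverse) i)).2 := by
      intro i
      funext j
      by_cases hj : j = k
      · subst hj; simp [Cell.only]
      · simp [Cell.only, Cell.tape, hj]
    by_cases hi : i = 0
    · subst hi
      dsimp only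
      rw [update_self]
      exact Prod.ext rfl (this 0)
    · dsimp only
      rw [update_of_ne hi]
      exact Prod.ext (by simp [Cell.tape, Cell.only, hi]) (this i)

end StackProg

end SingleTape

-- Moving entries between stacks

namespace SingleTape.StackProg

open Function

variable {K V : Type} [DecidableEq K]

/-- Push an entry onto several stacks. -/
def pushAll (v : V) : List K → StackProg K V
  | [] => .skip
  | k :: ks => .seq (.push k v) (pushAll v ks)

/-- Move the entries of the stack `k` to each of the stacks `ks`, reversing their order. -/
def pour (k : K) (ks : List K) : StackProg K V :=
  .loop k Option.isSome (.case k fun o => o.elim .skip fun v => .seq (.pop k) (pushAll v ks))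

theorem Exec.congr {P : StackProg K V} {σ σ₁ σ₂ : K → List V} {m n : ℕ} (h : P.Exec σ m σ₁)
    (hn : m = n) (hσ : ∀ j, σ₁ j = σ₂ j) : P.Exec σ n σ₂ := by
  obtain rfl : σ₁ = σ₂ := funext hσ
  exact hn ▸ h

theorem exec_pushAll (v : V) : ∀ (ks : List K) (σ : K → List V), ks.Nodup →
    (pushAll v ks).Exec σ (ks.length + 1) fun j => if j ∈ ks then v :: σ j else σ j
  | [], σ, _ => (Exec.skip σ).congr rfl (by simp)
  | k :: ks, σ, h => by
    refine (Exec.seq (.push k v σ) (exec_pushAll v ks _ (List.nodup_cons.1 h).2)).congr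
      (by rw [List.length_cons]; ring) fun j => ?_
    by_cases hj : j = k
    · subst hj; simp [(List.nodup_cons.1 h).1]
    · simp [hj]

/-- Per entry: the loop test, the case distinction, the pop, and `ks.length + 1` for the pushes. -/
theorem exec_pour (k : K) (ks : List K) (hk : k ∉ ks) (hks : ks.Nodup) :
    ∀ (l : List V) (σ : K → List V), σ k = l →
      (pour k ks).Exec σ (l.length * (ks.length + 4) + 1)
        fun j => if j = k then [] else if j ∈ ks then l.reverse ++ σ j else σ j
  | [], σ, h => by
    refine (Exec.loop_done (k := k) (p := Option.isSome) _ (by simp [h])).congr (by simp)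
      fun j => ?_
    by_cases hj : j = k
    · subst hj; simp [h]
    · simp [hj]
  | v :: l, σ, h => by
    have h₁ := Exec.seq (.pop k σ) (exec_pushAll v ks _ hks)
    have h₂ : (StackProg.case k fun o : Option V => o.elim StackProg.skip
        fun v => .seq (.pop k) (pushAll v ks)).Exec σ _ _ := .case (by rw [h]; exact h₁)
    refine (Exec.loop_step (p := Option.isSome) (by simp [h]) h₂
      (exec_pour k ks hk hks l _ (by simp [hk, h]))).congr
        (by simp only [List.length_cons]; ring) fun j => ?_
    by_cases hj : j = k
    · simp [hj]
    · by_cases hm : j ∈ ks <;> simp [hj, hm]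

end SingleTape.StackProg

namespace ForNo

open Function SingleTape

variable {R : Type*}

/-! ### Registers and constants of a term -/

/-- The registers of the atomic term are in `X` and its constants are bounded by `B`. -/
def Atom.Within (X : Set R) (B : ℕ) : Atom R → Prop
  | .skip => True
  | .push n x => x ∈ X ∧ n < B
  | .pop n x => x ∈ X ∧ n < B

/-- The registers of the safe term are in `X` and its constants are bounded by `B`. -/
def Safe.Within (X : Set R) (B : ℕ) : Safe R → Prop
  | .atom a => a.Within X B
  | .seq S₁ S₂ => S₁.Within X B ∧ S₂.Within X B
  | .cond x n S => x ∈ X ∧ n < B ∧ S.Within X B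
  | .forth x n P => x ∈ X ∧ n ≤ B ∧ ∀ i, (P i).Within X B
  | .back x n P => x ∈ X ∧ n ≤ B ∧ ∀ i, (P i).Within X B

/-- The registers of the term, except for the lists of normal blocks, are in `X` and its constants
are bounded by `B`. -/
def Term.Within (X : Set R) (B : ℕ) : Term R → Prop
  | .atom a => a.Within X B
  | .seq T₁ T₂ => T₁.Within X B ∧ T₂.Within X B
  | .cond x n T => x ∈ X ∧ n < B ∧ T.Within X B
  | .normal _ _ S => S.Within X B

theorem Atom.exists_within (a : Atom R) : ∃ (X₀ : Set R) (B₀ : ℕ), X₀.Finite ∧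
    ∀ X B, X₀ ⊆ X → B₀ ≤ B → a.Within X B := by
  rcases a with _ | ⟨n, x⟩ | ⟨n, x⟩
  · exact ⟨∅, 0, Set.finite_empty, fun _ _ _ _ => trivial⟩
  all_goals
    exact ⟨{x}, n + 1, Set.finite_singleton x, fun X B hX hB => ⟨hX rfl, hB⟩⟩

/-- Stating the bounds for all larger `X` and `B` lets those of the subterms be merged by unions and
by maxima or sums. -/
theorem Safe.exists_within (S : Safe R) : ∃ (X₀ : Set R) (B₀ : ℕ), X₀.Finite ∧
    ∀ X B, X₀ ⊆ X → B₀ ≤ B → S.Within X B := by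
  have iteration : ∀ (x : R) (n : ℕ) (P : Fin (n + 1) → Safe R),
      (∀ i, ∃ (X₀ : Set R) (B₀ : ℕ), X₀.Finite ∧
        ∀ X B, X₀ ⊆ X → B₀ ≤ B → (P i).Within X B) →
      ∃ (X₀ : Set R) (B₀ : ℕ), X₀.Finite ∧
        ∀ X B, X₀ ⊆ X → B₀ ≤ B → x ∈ X ∧ n ≤ B ∧ ∀ i, (P i).Within X B := by
    intro x n P h
    choose X₀ B₀ hfin h using h
    refine ⟨insert x (⋃ i, X₀ i), n + ∑ i, B₀ i, (Set.finite_iUnion hfin).insert x,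
      fun X B hX hB => ⟨hX (Set.mem_insert _ _), le_trans (Nat.le_add_right _ _) hB, fun i =>
        h i X B ((Set.subset_iUnion X₀ i).trans ((Set.subset_insert _ _).trans hX)) ?_⟩⟩
    have := Finset.single_le_sum (f := B₀) (fun _ _ => Nat.zero_le _) (Finset.mem_univ i)
    omega
  induction S with
  | atom a => exact a.exists_within
  | seq S₁ S₂ ih₁ ih₂ =>
    obtain ⟨X₁, B₁, f₁, h₁⟩ := ih₁
    obtain ⟨X₂, B₂, f₂, h₂⟩ := ih₂
    exact ⟨X₁ ∪ X₂, max B₁ B₂, f₁.union f₂, fun X B hX hB =>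
      ⟨h₁ X B (Set.subset_union_left.trans hX) (le_trans (le_max_left _ _) hB),
        h₂ X B (Set.subset_union_right.trans hX) (le_trans (le_max_right _ _) hB)⟩⟩
  | cond x n S ih =>
    obtain ⟨X₁, B₁, f₁, h₁⟩ := ih
    exact ⟨insert x X₁, max (n + 1) B₁, f₁.insert x, fun X B hX hB =>
      ⟨hX (Set.mem_insert _ _), le_trans (le_max_left _ _) hB,
        h₁ X B ((Set.subset_insert _ _).trans hX) (le_trans (le_max_right _ _) hB)⟩⟩
  | forth x n P ih => exact iteration x n P ih
  | back x n P ih => exact iteration x n P ih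

theorem Term.exists_within (T : Term R) : ∃ (X₀ : Set R) (B₀ : ℕ), X₀.Finite ∧
    ∀ X B, X₀ ⊆ X → B₀ ≤ B → T.Within X B := by
  induction T with
  | atom a => exact a.exists_within
  | seq T₁ T₂ ih₁ ih₂ =>
    obtain ⟨X₁, B₁, f₁, h₁⟩ := ih₁
    obtain ⟨X₂, B₂, f₂, h₂⟩ := ih₂
    exact ⟨X₁ ∪ X₂, max B₁ B₂, f₁.union f₂, fun X B hX hB =>
      ⟨h₁ X B (Set.subset_union_left.trans hX) (le_trans (le_max_left _ _) hB),
        h₂ X B (Set.subset_union_right.trans hX) (le_trans (le_max_right _ _) hB)⟩⟩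
  | cond x n T ih =>
    obtain ⟨X₁, B₁, f₁, h₁⟩ := ih
    exact ⟨insert x X₁, max (n + 1) B₁, f₁.insert x, fun X B hX hB =>
      ⟨hX (Set.mem_insert _ _), le_trans (le_max_left _ _) hB,
        h₁ X B ((Set.subset_insert _ _).trans hX) (le_trans (le_max_right _ _) hB)⟩⟩
  | normal y ys S => exact S.exists_within

/-! ### Read-only registers -/

section ReadOnly

variable [DecidableEq R]

theorem Atom.Eval.eq_of_not_writes {a : Atom R} {ω ω' : State R} (h : a.Eval ω ω') {x : R}
    (hx : ¬ a.Writes x) : ω'.1 x = ω.1 x := by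
  cases h with
  | skip => rfl
  | push n y => exact update_of_ne (fun e => hx e.symm) _ _
  | pop n y => exact update_of_ne (fun e => hx e.symm) _ _

/-- Induction on the term, with an inner induction on the stack that an iteration unfolds. -/
theorem Safe.Eval.eq_of_not_writes {S : Safe R} {x : R} (hx : ¬ S.Writes x) :
    ∀ {ω ω' : State R}, S.Eval ω ω' → ω'.1 x = ω.1 x := by
  have iteration : ∀ (n : ℕ) (P : Fin (n + 1) → Safe R),
      (∀ i, ∀ {ω ω' : State R}, (P i).Eval ω ω' → ω'.1 x = ω.1 x) →
      ∀ (l : Stack) (ω ω' : State R), Safe.Iter l n P ω ω' → ω'.1 x = ω.1 x := by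
    intro n P hP l
    induction l with
    | nil => rintro ω ω' ⟨⟩; rfl
    | cons i l ih =>
      rintro ω ω' (_ | ⟨_, _, _, _, _, ω₁, _, h₁, h₂⟩)
      rw [ih _ _ h₂, hP _ h₁]
  induction S with
  | atom a => rintro ω ω' ⟨_, _, _, h⟩; exact h.eq_of_not_writes hx
  | seq S₁ S₂ ih₁ ih₂ =>
    rintro ω ω' h
    cases h with
    | seq _ _ _ ω₁ _ h₁ h₂ => rw [ih₂ (fun h => hx (.inr h)) h₂, ih₁ (fun h => hx (.inl h)) h₁]
  | cond y n S ih =>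
    rintro ω ω' h
    cases h with
    | cond_eq _ _ _ _ _ _ h => exact ih hx h
    | cond_neq => rfl
  | forth y n P ih =>
    rintro ω ω' h
    cases h with
    | forth _ _ _ _ _ h => exact iteration n P (fun i => ih i fun h => hx ⟨i, h⟩) _ _ _ h
  | back y n P ih =>
    rintro ω ω' h
    cases h with
    | back _ _ _ _ _ h => exact iteration n P (fun i => ih i fun h => hx ⟨i, h⟩) _ _ _ h

end ReadOnly

end ForNo

namespace ForNo

open Function SingleTape

variable {R : Type*}

/-! ### Simulation of terms by programs for stacks -/

/-- The stacks of a simulation: one for each register, one for the counter in unary, one for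
temporary use, and one for the entries that pending iterations still have to run through. -/
inductive Track (ι : Type) : Type
  | reg (i : ι) : Track ι
  | cnt : Track ι
  | tmp : Track ι
  | aux : Track ι
  deriving DecidableEq

instance {ι : Type} [Finite ι] : Finite (Track ι) :=
  .of_surjective (fun o : ι ⊕ Fin 3 => o.elim .reg ![.cnt, .tmp, .aux]) fun
    | .reg i => ⟨.inl i, rfl⟩
    | .cnt => ⟨.inr 0, rfl⟩
    | .tmp => ⟨.inr 1, rfl⟩
    | .aux => ⟨.inr 2, rfl⟩

/-- Numbers up to `B`, and `none`, which serves as a separator and as the unit of the counter. -/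
abbrev Entry (B : ℕ) : Type := Option (Fin (B + 1))

/-- The entry representing `n`. All numbers from `B` on are identified. -/
def entry (B n : ℕ) : Entry B := some ⟨min n B, by omega⟩

theorem entry_eq_iff {B m n : ℕ} (hn : n < B) : entry B m = entry B n ↔ m = n := by
  simp only [entry, Option.some.injEq, Fin.mk.injEq]
  omega

variable {ι : Type} (ν : ι → R) (B : ℕ)

/-- The stacks representing a state. -/
def tracks (ω : State R) (a : List (Entry B)) : Track ι → List (Entry B)
  | .reg i => (ω.1 (ν i)).map (entry B)
  | .cnt => List.replicate ω.2 none
  | .tmp => []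
  | .aux => a

variable {ν B}

theorem head?_tracks_iff {n : ℕ} (hn : n < B) (ω : State R) (a : List (Entry B)) (i : ι) :
    (tracks ν B ω a (.reg i)).head? = some (entry B n) ↔ (ω.1 (ν i)).head? = some n := by
  rw [tracks]
  cases ω.1 (ν i) <;> simp [entry_eq_iff hn]

variable [DecidableEq ι]

theorem tracks_counter (φ : R → Stack) (c d : ℕ) (a : List (Entry B)) :
    tracks ν B (φ, d) a = update (tracks ν B (φ, c) a) .cnt (List.replicate d none) := by
  funext j
  rcases j with j | _ | _ | _ <;> rfl

theorem tracks_aux (ω : State R) (a b : List (Entry B)) :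
    tracks ν B ω b = update (tracks ν B ω a) .aux b := by
  funext j
  rcases j with j | _ | _ | _ <;> rfl

variable [DecidableEq R]

theorem tracks_update (hν : Injective ν) (i : ι) (s : Stack) (φ : R → Stack) (c : ℕ)
    (a : List (Entry B)) : tracks ν B (update φ (ν i) s, c) a =
      update (tracks ν B (φ, c) a) (.reg i) (s.map (entry B)) := by
  funext j
  rcases j with j | _ | _ | _ <;> try rfl
  by_cases h : j = i
  · subst h; simp [tracks]
  · have : ν j ≠ ν i := hν.ne h
    have h' : Track.reg j ≠ Track.reg i := by simpa using h
    rw [update_of_ne h']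
    simp [tracks, this]

theorem Atom.exists_stackProg (hν : Injective ν) (A : Atom R) (hA : A.Within (Set.range ν) B) :
    ∃ P : StackProg (Track ι) (Entry B), ∀ ω ω', A.Eval ω ω' → ∀ a, ∃ n ≤ 3,
      P.Exec (tracks ν B ω a) n (tracks ν B ω' a) := by
  rcases A with _ | ⟨n, x⟩ | ⟨n, x⟩
  · refine ⟨.skip, ?_⟩
    rintro ω _ ⟨⟩ a
    exact ⟨1, by omega, .skip _⟩
  · obtain ⟨⟨i, rfl⟩, hn⟩ := hA
    -- Here `o = none` means that the counter is zero; its unit is read as `some none`.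
    refine ⟨.case .cnt fun o => if o = none then .push (.reg i) (entry B n) else
      .case (.reg i) fun o => if o = some (entry B n) then .skip else .pop .cnt, ?_⟩
    rintro _ _ h a
    cases h with
    | push _ _ φ c s d h =>
      rw [tracks_update hν]
      rcases c with _ | c
      · obtain ⟨rfl, rfl⟩ := Prod.mk.inj h
        exact ⟨2, by omega, .case (.push _ _ _)⟩
      · rw [ForNo.push] at h
        split_ifs at h with hd
        · obtain ⟨rfl, rfl⟩ := Prod.mk.inj h
          refine ⟨3, le_rfl, .case (.case ?_)⟩
          rw [if_pos ((head?_tracks_iff hn _ _ _).2 hd)]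
          exact (StackProg.Exec.skip _).congr rfl fun j => by
            rw [← tracks_update hν, update_eq_self]
        · obtain ⟨rfl, rfl⟩ := Prod.mk.inj h
          refine ⟨3, le_rfl, .case (.case ?_)⟩
          rw [if_neg (mt (head?_tracks_iff hn _ _ _).1 hd)]
          exact (StackProg.Exec.pop _ _).congr rfl fun j => by
            rw [← tracks_update hν, update_eq_self, tracks_counter φ (c + 1) c]
            rfl
  · obtain ⟨⟨i, rfl⟩, hn⟩ := hA
    refine ⟨.case .cnt fun o => .case (.reg i) fun o' => if o' = some (entry B n) then
      if o = none then .pop (.reg i) else .skip else .push .cnt none, ?_⟩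
    rintro _ _ h a
    cases h with
    | pop _ _ φ c s d h =>
      rw [tracks_update hν]
      refine ⟨3, le_rfl, .case (.case ?_)⟩
      by_cases hd : (φ (ν i)).head? = some n
      · rw [if_pos ((head?_tracks_iff hn _ _ _).2 hd)]
        rcases c with _ | c
        · rw [ForNo.pop, if_pos hd] at h
          obtain ⟨rfl, rfl⟩ := Prod.mk.inj h
          exact (StackProg.Exec.pop _ _).congr rfl fun j => by rw [List.map_tail]; rfl
        · rw [ForNo.pop, if_pos hd] at h
          obtain ⟨rfl, rfl⟩ := Prod.mk.inj h
          exact (StackProg.Exec.skip _).congr rfl fun j => by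
            rw [← tracks_update hν, update_eq_self]
      · rw [if_neg (mt (head?_tracks_iff hn _ _ _).1 hd)]
        obtain ⟨rfl, rfl⟩ : s = φ (ν i) ∧ d = c + 1 := by
          rcases c with _ | c <;> rw [ForNo.pop, if_neg hd] at h <;>
            exact ⟨(Prod.mk.inj h).1.symm, (Prod.mk.inj h).2.symm⟩
        exact (StackProg.Exec.push _ _ _).congr rfl fun j => by
          rw [← tracks_update hν, update_eq_self, tracks_counter φ c (c + 1)]
          rfl

/-- Run through the entries on the auxiliary stack down to the separator, and remove it. -/
def iterate (n : ℕ) (Q : Fin (n + 1) → StackProg (Track ι) (Entry B)) :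
    StackProg (Track ι) (Entry B) :=
  .seq (.loop .aux (fun o => o.join.isSome) (.case .aux fun o => o.join.elim .skip fun v =>
    .seq (.pop .aux) (Q ⟨min v n, by omega⟩))) (.pop .aux)

/-- The bodies are simulated for arbitrary contents of the auxiliary stack and restore them, so the
entries still to come survive nested iterations. The invariant `I` is what guarantees the common
bound `c` in every round; test, case distinction and pop add `3`. -/
theorem exec_iterate {n : ℕ} (hn : n ≤ B) {P : Fin (n + 1) → Safe R}
    {Q : Fin (n + 1) → StackProg (Track ι) (Entry B)} (I : State R → Prop) {c : ℕ}
    (hI : ∀ j ω ω', (P j).Eval ω ω' → I ω → I ω')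
    (hQ : ∀ j ω ω', (P j).Eval ω ω' → I ω → ∀ a, ∃ m ≤ c,
      (Q j).Exec (tracks ν B ω a) m (tracks ν B ω' a)) (a : List (Entry B)) (l : Stack)
    (ω ω' : State R) (h : Safe.Iter l n P ω ω') (hω : I ω) : ∃ m ≤ l.length * (c + 3) + 2,
      (iterate n Q).Exec (tracks ν B ω (l.map (entry B) ++ none :: a)) m (tracks ν B ω' a) := by
  suffices H : ∃ m ≤ l.length * (c + 3) + 1,
      (StackProg.loop .aux (fun o => o.join.isSome) (.case .aux fun o => o.join.elim .skip fun v =>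
        .seq (.pop .aux) (Q ⟨min v n, by omega⟩))).Exec
          (tracks ν B ω (l.map (entry B) ++ none :: a)) m (tracks ν B ω' (none :: a)) by
    obtain ⟨m, hm, H⟩ := H
    exact ⟨m + 1, by omega, .seq H ((StackProg.Exec.pop _ _).congr rfl fun j => by
      rw [tracks_aux ω' (none :: a) a]; rfl)⟩
  induction l generalizing ω with
  | nil => cases h; exact ⟨1, by omega, .loop_done _ rfl⟩
  | cons i l ih =>
    cases h with
    | step _ _ _ _ _ ω₁ _ h₁ h₂ =>
      obtain ⟨m, hm, e₂⟩ := ih ω₁ h₂ (hI _ _ _ h₁ hω)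
      obtain ⟨k, hk, e₁⟩ := hQ _ _ _ h₁ hω (l.map (entry B) ++ none :: a)
      have e₀ := StackProg.Exec.pop .aux (tracks ν B ω ((i :: l).map (entry B) ++ none :: a))
      have hpop : update (tracks ν B ω ((i :: l).map (entry B) ++ none :: a)) .aux
          (tracks ν B ω ((i :: l).map (entry B) ++ none :: a) .aux).tail =
          tracks ν B ω (l.map (entry B) ++ none :: a) :=
        (tracks_aux ω ((i :: l).map (entry B) ++ none :: a) _).symm
      rw [hpop] at e₀
      refine ⟨1 + k + 1 + m + 1, ?_, .loop_step rfl (.case (.seq e₀ ?_)) e₂⟩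
      · rw [List.length_cons, add_mul]
        omega
      -- Truncating entries at `B` does not affect the choice of the body: `min (min i B) n = min i
      -- n`, as `n ≤ B`.
      · convert e₁ using 3
        simp only
        omega

/-- The set `Y` contains all leaders and is never written, so the same `ℓ` is valid at every moment
of the run. Hence bounds add up in sequences instead of being composed, and an iteration multiplies
the bound of its bodies by at most `ℓ`, up to a linear term. -/
theorem Safe.exists_stackProg (hν : Injective ν) (S : Safe R) (Y : Set R)
    (hS : S.Within (Set.range ν) B) (hY : ∀ x ∈ Y, ¬ S.Writes x)
    (hL : ∀ x, S.LeadsIteration x → x ∈ Y) :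
    ∃ (P : StackProg (Track ι) (Entry B)) (p : Polynomial ℕ), ∀ ω ω', S.Eval ω ω' →
      ∀ ℓ, (∀ i, ν i ∈ Y → (ω.1 (ν i)).length ≤ ℓ) → ∀ a, ∃ n ≤ p.eval ℓ,
        P.Exec (tracks ν B ω a) n (tracks ν B ω' a) := by
  have bodies : ∀ (n : ℕ) (P : Fin (n + 1) → Safe R), n ≤ B → (∀ x ∈ Y, ∀ i, ¬ (P i).Writes x) →
      (∀ i, ∃ (Q : StackProg (Track ι) (Entry B)) (p : Polynomial ℕ), ∀ ω ω', (P i).Eval ω ω' →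
        ∀ ℓ, (∀ i, ν i ∈ Y → (ω.1 (ν i)).length ≤ ℓ) → ∀ a, ∃ n ≤ p.eval ℓ,
          Q.Exec (tracks ν B ω a) n (tracks ν B ω' a)) →
      ∃ (Q : StackProg (Track ι) (Entry B)) (p : Polynomial ℕ), ∀ l ω ω', Safe.Iter l n P ω ω' →
        ∀ ℓ, (∀ i, ν i ∈ Y → (ω.1 (ν i)).length ≤ ℓ) → l.length ≤ ℓ → ∀ a, ∃ n ≤ p.eval ℓ,
          Q.Exec (tracks ν B ω (l.map (entry B) ++ none :: a)) n (tracks ν B ω' a) := by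
    intro n P hn hY h
    choose Q p h using h
    -- The sum over the bodies bounds the cost of whichever body an entry selects.
    refine ⟨iterate n Q, Polynomial.X * (∑ i, p i + 3) + 2, fun l ω ω' hl ℓ hℓ hle a => ?_⟩
    obtain ⟨m, hm, e⟩ := exec_iterate hn (Q := Q)
      (fun ω => ∀ i, ν i ∈ Y → (ω.1 (ν i)).length ≤ ℓ) (c := ∑ i, (p i).eval ℓ)
      (fun j ω ω' h hω i hi => by rw [h.eq_of_not_writes (hY _ hi j)]; exact hω i hi)
      (fun j ω ω' hj hω a => by
        obtain ⟨m, hm, e⟩ := h j ω ω' hj ℓ hω a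
        exact ⟨m, hm.trans (Finset.single_le_sum (f := fun i => (p i).eval ℓ)
          (fun _ _ => Nat.zero_le _) (Finset.mem_univ j)), e⟩) a l ω ω' hl hℓ
    refine ⟨m, hm.trans ?_, e⟩
    simp only [Polynomial.eval_add, Polynomial.eval_mul, Polynomial.eval_X,
      Polynomial.eval_ofNat, Polynomial.eval_finsetSum]
    gcongr
  induction S with
  | atom A =>
    obtain ⟨P, hP⟩ := A.exists_stackProg hν hS
    refine ⟨P, 3, fun ω ω' h ℓ _ a => ?_⟩
    cases h with
    | atom _ _ _ h => simpa using hP _ _ h a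
  | seq S₁ S₂ ih₁ ih₂ =>
    obtain ⟨P₁, p₁, h₁⟩ := ih₁ hS.1 (fun x hx h => hY x hx (.inl h)) fun x h => hL x (.inl h)
    obtain ⟨P₂, p₂, h₂⟩ := ih₂ hS.2 (fun x hx h => hY x hx (.inr h)) fun x h => hL x (.inr h)
    refine ⟨.seq P₁ P₂, p₁ + p₂, fun ω ω' h ℓ hℓ a => ?_⟩
    cases h with
    | seq _ _ _ ω₁ _ e₁ e₂ =>
      obtain ⟨n₁, hn₁, s₁⟩ := h₁ _ _ e₁ ℓ hℓ a
      obtain ⟨n₂, hn₂, s₂⟩ := h₂ _ _ e₂ ℓ (fun i hi => by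
        rw [e₁.eq_of_not_writes fun h => hY _ hi (.inl h)]; exact hℓ i hi) a
      exact ⟨_, by rw [Polynomial.eval_add]; exact add_le_add hn₁ hn₂, .seq s₁ s₂⟩
  | cond x m S ih =>
    obtain ⟨⟨i, rfl⟩, hm, hS⟩ := hS
    obtain ⟨P, p, hP⟩ := ih hS hY hL
    refine ⟨.case (.reg i) fun o => if o = some (entry B m) then P else .skip, p + 2,
      fun ω ω' h ℓ hℓ a => ?_⟩
    cases h with
    | cond_eq _ _ _ _ _ hd h =>
      obtain ⟨n, hn, e⟩ := hP _ _ h ℓ hℓ a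
      refine ⟨n + 1, by simp; omega, .case ?_⟩
      rw [if_pos ((head?_tracks_iff hm _ _ _).2 hd)]
      exact e
    | cond_neq _ _ _ _ hd =>
      refine ⟨1 + 1, by simp, .case ?_⟩
      rw [if_neg (mt (head?_tracks_iff hm _ _ _).1 hd)]
      exact .skip _
  | forth x n P ih =>
    obtain ⟨⟨i, rfl⟩, hn, hS⟩ := hS
    obtain ⟨Q, p, hQ⟩ := bodies n P hn (fun x hx j h => hY x hx ⟨j, h⟩) fun j =>
      ih j (hS j) (fun x hx h => hY x hx ⟨j, h⟩) fun x h => hL x (.inr ⟨j, h⟩)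
    -- Pouring twice restores the order, so the register is recovered and its copy on `aux` has the
    -- top first. The two transfers cost `5 * ℓ + 1` and `6 * ℓ + 1` at most, the separator `1`.
    refine ⟨.seq (.push .aux none) (.seq (.pour (.reg i) [.tmp])
      (.seq (.pour .tmp [.reg i, .aux]) Q)), Polynomial.X * 11 + 3 + p, fun ω ω' h ℓ hℓ a => ?_⟩
    cases h with
    | forth _ _ _ _ _ h =>
      have hle := hℓ i (hL _ (.inl rfl))
      obtain ⟨m, hm, e⟩ := hQ _ _ _ h ℓ hℓ hle a
      refine ⟨_, ?_, .seq (.push _ _ _) (.seq (StackProg.exec_pour _ _ (by simp) (by simp) _ _ rfl)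
        (.seq ((StackProg.exec_pour Track.tmp [Track.reg i, Track.aux] (by simp) (by simp)
          ((ω.1 (ν i)).map (entry B)).reverse _ ?_).congr rfl fun j => ?_) e))⟩
      · simp [tracks]
        omega
      · simp [tracks]
      · rcases j with j | _ | _ | _
        · by_cases hj : j = i
          · subst hj; simp [tracks]
          · simp [tracks, hj]
        all_goals simp [tracks]
  | back x n P ih =>
    obtain ⟨⟨i, rfl⟩, hn, hS⟩ := hS
    obtain ⟨Q, p, hQ⟩ := bodies n P hn (fun x hx j h => hY x hx ⟨j, h⟩) fun j =>
      ih j (hS j) (fun x hx h => hY x hx ⟨j, h⟩) fun x h => hL x (.inr ⟨j, h⟩)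
    -- The copy on `aux` is now made by the first transfer, which reverses the order.
    refine ⟨.seq (.push .aux none) (.seq (.pour (.reg i) [.tmp, .aux])
      (.seq (.pour .tmp [.reg i]) Q)), Polynomial.X * 11 + 3 + p, fun ω ω' h ℓ hℓ a => ?_⟩
    cases h with
    | back _ _ _ _ _ h =>
      have hle := hℓ i (hL _ (.inl rfl))
      obtain ⟨m, hm, e⟩ := hQ _ _ _ h ℓ hℓ (by simpa using hle) a
      refine ⟨_, ?_, .seq (.push _ _ _) (.seq (StackProg.exec_pour _ _ (by simp) (by simp) _ _ rfl)
        (.seq ((StackProg.exec_pour Track.tmp [Track.reg i] (by simp) (by simp)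
          ((ω.1 (ν i)).map (entry B)).reverse _ ?_).congr rfl fun j => ?_) e))⟩
      · simp [tracks]
        omega
      · simp [tracks]
      · rcases j with j | _ | _ | _
        · by_cases hj : j = i
          · subst hj; simp [tracks]
          · simp [tracks, hj]
        all_goals simp [tracks]

theorem Term.exists_stackProg (hν : Injective ν) (T : Term R) (hT : T.IsForNo)
    (hW : T.Within (Set.range ν) B) :
    ∃ (P : StackProg (Track ι) (Entry B)) (p : Polynomial ℕ), ∀ ω ω', T.Eval ω ω' →
      ∀ ℓ, (∀ i, (ω.1 (ν i)).length ≤ ℓ) → ∃ n ≤ p.eval ℓ,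
        P.Exec (tracks ν B ω []) n (tracks ν B ω' []) := by
  induction T with
  | atom A =>
    obtain ⟨P, hP⟩ := A.exists_stackProg hν hW
    refine ⟨P, 3, fun ω ω' h ℓ _ => ?_⟩
    cases h with
    | atom _ _ _ h => simpa using hP _ _ h []
  | seq T₁ T₂ ih₁ ih₂ =>
    obtain ⟨P₁, p₁, h₁⟩ := ih₁ hT.1 hW.1
    obtain ⟨P₂, p₂, h₂⟩ := ih₂ hT.2 hW.2
    -- The first part may lengthen registers by its running time, so the second has the bound `p₂`
    -- at `ℓ + p₁(ℓ)`.
    refine ⟨.seq P₁ P₂, p₁ + p₂.comp (Polynomial.X + p₁), fun ω ω' h ℓ hℓ => ?_⟩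
    cases h with
    | seq _ _ _ ω₁ _ e₁ e₂ =>
      obtain ⟨n₁, hn₁, s₁⟩ := h₁ _ _ e₁ ℓ hℓ
      obtain ⟨n₂, hn₂, s₂⟩ := h₂ _ _ e₂ (ℓ + p₁.eval ℓ) fun i => by
        have := s₁.length_le (.reg i)
        simp only [tracks, List.length_map] at this
        have := hℓ i
        omega
      refine ⟨_, ?_, .seq s₁ s₂⟩
      simp only [Polynomial.eval_add, Polynomial.eval_comp, Polynomial.eval_X]
      exact add_le_add hn₁ hn₂
  | cond x m T ih =>
    obtain ⟨⟨i, rfl⟩, hm, hW⟩ := hW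
    obtain ⟨P, p, hP⟩ := ih hT.2 hW
    refine ⟨.case (.reg i) fun o => if o = some (entry B m) then P else .skip, p + 2,
      fun ω ω' h ℓ hℓ => ?_⟩
    cases h with
    | cond_eq _ _ _ _ _ hd h =>
      obtain ⟨n, hn, e⟩ := hP _ _ h ℓ hℓ
      refine ⟨n + 1, by simp; omega, .case ?_⟩
      rw [if_pos ((head?_tracks_iff hm _ _ _).2 hd)]
      exact e
    | cond_neq _ _ _ _ hd =>
      refine ⟨1 + 1, by simp, .case ?_⟩
      rw [if_neg (mt (head?_tracks_iff hm _ _ _).1 hd)]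
      exact .skip _
  | normal y ys S =>
    obtain ⟨P, p, hP⟩ := S.exists_stackProg hν {x | x ∈ y :: ys} hW hT.2.1 hT.2.2
    refine ⟨P, p, fun ω ω' h ℓ hℓ => ?_⟩
    cases h with
    | normal _ _ _ _ _ h => exact hP _ _ h ℓ (fun i _ => hℓ i) []

-- Soundness

theorem Term.Computes.fptime {A : Type*} [Fintype A] {T : Term R} (hT : T.IsForNo)
    {f : List A → List A} (hf : T.Computes f) : FPTIME f := by
  obtain ⟨e, inp, out, hf⟩ := hf
  obtain ⟨X₀, B₀, hfin, hX₀⟩ := T.exists_within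
  let X : Finset R := insert inp (insert out hfin.toFinset)
  let ν : Fin X.card → R := fun i => X.equivFin.symm i
  have hν : Injective ν := Subtype.val_injective.comp X.equivFin.symm.injective
  have hrange : Set.range ν = X := by
    rw [Set.range_comp' Subtype.val, Equiv.range_eq_univ]
    simp
  -- With `B ≥ |A|`, truncation keeps the codes of the letters distinct.
  let B := max B₀ (Fintype.card A)
  obtain ⟨P, p, hP⟩ := T.exists_stackProg hν (B := B) hT (hX₀ _ _ (by
    rw [hrange]; intro x hx; simp [X, hx]) (le_max_left _ _))
  obtain ⟨i, hi⟩ : inp ∈ Set.range ν := by rw [hrange]; simp [X]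
  obtain ⟨o, ho⟩ : out ∈ Set.range ν := by rw [hrange]; simp [X]
  let letter : A ↪ Entry B := ⟨fun a => entry B (e a), fun a b hab => by
    have hb : (e b : ℕ) < B := (e b).2.trans_le (le_max_right _ _)
    exact e.injective (Fin.ext ((entry_eq_iff hb).1 hab))⟩
  have hletter : ∀ w : List A, (encode e w).map (entry B) = w.map letter := fun w => by
    simp only [encode, List.map_map]
    rfl
  -- Input and output are expected on one stack with the first letter at the bottom. The auxiliary
  -- stack, empty before and after `P`, serves for both, and pouring provides the reversal.
  refine StackProg.fptime (.seq (.pour .aux [.reg i]) (.seq P (.pour (.reg o) [.aux]))) .aux letter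
    f (Polynomial.X * 5 + 1 + (p + ((Polynomial.X + p) * 5 + 1))) fun w => ?_
  obtain ⟨φ, hφ, hout⟩ := hf w
  obtain ⟨n, hn, e₂⟩ := hP _ _ hφ w.length fun j => by
    by_cases hj : ν j = inp
    · simp [hj, encode]
    · simp [hj]
  have e₁ := (StackProg.exec_pour (Track.aux) [Track.reg i] (by simp) (by simp) _
    (update (fun _ => []) .aux (w.map letter).reverse) rfl).congr rfl
      (σ₂ := tracks ν B (update (fun _ => []) inp (encode e w), 0) []) fun j => by
    rw [← hi, tracks_update hν, hletter]
    rcases j with j | _ | _ | _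
    · by_cases hj : j = i
      · subst hj; simp
      · simp [tracks, hj]
    all_goals simp [tracks]
  have e₃ := StackProg.exec_pour (Track.reg o) [Track.aux] (by simp) (by simp) _
    (tracks ν B (φ, 0) []) rfl
  have hlen := e₂.length_le (.reg o)
  have hw : (tracks ν B (update (fun _ => []) inp (encode e w), 0) [] (.reg o)).length ≤
      w.length := by
    rw [← hi, tracks_update hν, hletter]
    by_cases hj : o = i
    · simp [hj]
    · simp [tracks, hj]
  refine ⟨_, ?_, _, .seq e₁ (.seq e₂ e₃), ?_⟩
  · simp only [Polynomial.eval_add, Polynomial.eval_mul, Polynomial.eval_X, Polynomial.eval_one,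
      Polynomial.eval_ofNat, update_self, List.length_reverse, List.length_map, List.length_cons,
      List.length_nil]
    omega
  · simp [tracks, ho, hout, hletter]

end ForNo

theorem theorem3 {R : Type*} [DecidableEq R] {A : Type*} [Fintype A]
    (T : ForNo.Term R) (hT : T.IsForNo) (f : List A → List A) (hf : T.Computes f) :
    SingleTape.FPTIME f :=
  hf.fptime hT
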